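/- An interval exchange transformation (IET) $T$ of $[0,1)$ is a bijection of $[0,1)$ that translates each of finitely many intervals $[b_{i-1},b_i)$, $0=b_0<b_1<\dots<b_n=1$, where $n$ is minimal. Its lengths are $\lambda(T)=(b_i-b_{i-1})_{1\le i\le n}$, its set of discontinuities is $\Delta(T)=\{b_1,\dots,b_{n-1}\}$, its permutation is $\pi(T)=\sigma\in\mathfrak S_n$, where $\sigma(i)$ is the position of the image of the $i$-th interval, and $\omega(T)=(t_1,\dots,t_n)$ are its translation lengths, i.e. $T(x)=x+t_i$ on $[b_{i-1},b_i)$. The set $\mathrm{IET}$ of all IETs of $[0,1)$ carries the distance $d(S,T)=\|\lambda(S)-\lambda(T)\|_1$ if $\pi(S)=\pi(T)$, and $d(S,T)=\infty$ otherwise. For a positive integer $q$, $T$ is $q$-rational if $\Delta(T)\subset\frac1q\mathbb Z$, and it is rational if it is $q'$-rational for some positive integer $q'$. A permutation $\sigma\in\mathfrak S_n$ is driftable if there are two IETs $T,T'$ with permutation $\sigma$ (that is, with $\lambda(T')=\lambda(T)+(d_1,\dots,d_n)$, $\sum_i d_i=0$) such that every translation length of $T'$ is strictly larger than the corresponding translation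 length of $T$. Proposition. Let $q$ be a positive integer, let $T_0$ be a $q$-rational IET whose permutation $\sigma=\pi(T_0)$ is driftable, and let $S$ be any IET. Then there are a set $\mathcal U\subset\mathrm{IET}$ containing $S$ and an open set $\mathcal V$ of IETs with permutation $\sigma$, having $T_0$ as an accumulation point, such that for all $R\in\mathcal U$ and $T\in\mathcal V$ the group $\langle R,T\rangle$ is not free of rank $2$. More precisely, for all such $R$ and $T$ there is an integer $k\ge 1$ such that $$[U,\,T^kUT^{-k}]=\mathrm{id},\qquad U=[T^{q!},\,RT^{q!}R^{-1}],$$ where $[a,b]=aba^{-1}b^{-1}$, and the corresponding word is a non-trivial element of the free group on two letters. Moreover, if $S$ is rational, or if distinct points of $\Delta(S)$ are never congruent modulo $\frac1q\mathbb Z$, then $\mathcal U$ is a neighbourhood of $S$. -/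

import Mathlib

open Topology
open scoped commutatorElement

noncomputable section

/-- The left endpoint of the `i`-th interval when intervals of lengths `l` are laid side by side
from `0`, the `j`-th one being put at position `σ j`. -/
def leftEnd {n : ℕ} (σ : Equiv.Perm (Fin n)) (l : Fin n → ℝ) (i : Fin n) : ℝ :=
  ∑ j with σ j < σ i, l j

/-- The translation lengths `(t_1, …, t_n)` attached to a permutation and to lengths:
the left endpoint of the image of the `i`-th interval minus its own left endpoint. -/
def translationLength {n : ℕ} (σ : Equiv.Perm (Fin n)) (l : Fin n → ℝ) (i : Fin n) : ℝ :=
  leftEnd σ l i - leftEnd 1 l i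

/-- A permutation `σ` is driftable if, for lengths `l` of an IET with permutation `σ`, there is `d`
with `∑ d_i = 0` such that the IET with permutation `σ` and lengths `l + d` has all its
translation lengths larger than those of the first one. (Since translation lengths are linear
in the lengths, this does not depend on `l`.) -/
def Driftable {n : ℕ} (σ : Equiv.Perm (Fin n)) : Prop :=
  ∃ l d : Fin n → ℝ, (∀ i, 0 < l i) ∧ ∑ i, l i = 1 ∧ ∑ i, d i = 0 ∧ (∀ i, 0 < l i + d i) ∧
    ∀ i, translationLength σ l i < translationLength σ (fun j => l j + d j) i

/-- An interval exchange transformation of `[0,1)`, given by the number `n` of its intervals of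
continuity, its underlying permutation (`perm i` is the position of the image of the `i`-th
interval) and the lengths of its intervals. The field `reduced` says that two consecutive
intervals do not stay consecutive, so the `n` intervals are exactly the intervals of continuity.
The transformation itself is `IET.toPerm`. -/
structure IET where
  n : ℕ
  perm : Equiv.Perm (Fin n)
  len : Fin n → ℝ
  len_pos : ∀ i, 0 < len i
  len_sum : ∑ i, len i = 1
  reduced : ∀ i j : Fin n, (j : ℕ) = i + 1 → (perm j : ℕ) ≠ perm i + 1

section Tiling

variable {n : ℕ} (σ : Equiv.Perm (Fin n)) (l : Fin n → ℝ)

theorem leftEnd_add_le_of_lt (hl : ∀ i, 0 < l i) {i j : Fin n} (h : σ i < σ j) :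
    leftEnd σ l i + l i ≤ leftEnd σ l j := by
  unfold leftEnd
  rw [add_comm, ← Finset.sum_insert (by simp)]
  apply Finset.sum_le_sum_of_subset_of_nonneg
  · intro k hk
    simp only [Finset.mem_insert, Finset.mem_filter, Finset.mem_univ, true_and] at hk ⊢
    rcases hk with rfl | hk
    · exact h
    · exact hk.trans h
  · intro k _ _
    exact (hl k).le

theorem leftEnd_nonneg (hl : ∀ i, 0 < l i) (i : Fin n) : 0 ≤ leftEnd σ l i :=
  Finset.sum_nonneg fun k _ => (hl k).le

theorem leftEnd_add_le_one (hl : ∀ i, 0 < l i) (hs : ∑ i, l i = 1) (i : Fin n) :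
    leftEnd σ l i + l i ≤ 1 := by
  unfold leftEnd
  rw [add_comm, ← Finset.sum_insert (by simp), ← hs]
  exact Finset.sum_le_sum_of_subset_of_nonneg (Finset.subset_univ _) fun k _ _ => (hl k).le

/-- The map from the disjoint union of the intervals `[0, l_i)` to `[0,1)` that puts the `i`-th
interval at position `σ i`. -/
def tileFun (hl : ∀ i, 0 < l i) (hs : ∑ i, l i = 1) :
    (Σ i : Fin n, Set.Ico (0 : ℝ) (l i)) → Set.Ico (0 : ℝ) 1 :=
  fun p => ⟨leftEnd σ l p.1 + p.2.1,
    add_nonneg (leftEnd_nonneg σ l hl p.1) p.2.2.1,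
    lt_of_lt_of_le (add_lt_add_of_le_of_lt le_rfl p.2.2.2) (leftEnd_add_le_one σ l hl hs p.1)⟩

theorem tileFun_bijective (hl : ∀ i, 0 < l i) (hs : ∑ i, l i = 1) :
    Function.Bijective (tileFun σ l hl hs) := by
  constructor
  · rintro ⟨i, s, hs0, hs1⟩ ⟨j, t, ht0, ht1⟩ h
    have h' : leftEnd σ l i + s = leftEnd σ l j + t := congrArg Subtype.val h
    rcases lt_trichotomy (σ i) (σ j) with hij | hij | hij
    · have := leftEnd_add_le_of_lt σ l hl hij
      linarith
    · obtain rfl := σ.injective hij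
      obtain rfl : s = t := by linarith
      rfl
    · have := leftEnd_add_le_of_lt σ l hl hij
      linarith
  · rintro ⟨x, hx0, hx1⟩
    have hn : 0 < n := by
      rcases Nat.eq_zero_or_pos n with rfl | h
      · simp at hs
      · exact h
    have hne : (Finset.univ.filter fun i => leftEnd σ l i ≤ x).Nonempty := by
      refine ⟨σ.symm ⟨0, hn⟩, ?_⟩
      have : leftEnd σ l (σ.symm ⟨0, hn⟩) = 0 := by
        unfold leftEnd
        apply Finset.sum_eq_zero
        intro j hj
        simp [Fin.lt_def] at hj
      simp [this, hx0]
    obtain ⟨i, hi, hmax⟩ := Finset.exists_max_image _ (fun i => σ i) hne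
    simp only [Finset.mem_filter, Finset.mem_univ, true_and] at hi hmax
    have hlt : x < leftEnd σ l i + l i := by
      by_contra! hcon
      by_cases hlast : (σ i : ℕ) + 1 < n
      · have hk := hmax (σ.symm ⟨(σ i : ℕ) + 1, hlast⟩) (by
          refine le_trans (le_of_eq ?_) hcon
          unfold leftEnd
          rw [add_comm (Finset.sum _ _), ← Finset.sum_insert (by simp)]
          congr 1
          ext j
          simp only [Finset.mem_filter, Finset.mem_univ, true_and, Finset.mem_insert,
            Equiv.apply_symm_apply, Fin.lt_def, ← σ.injective.eq_iff (a := j), Fin.ext_iff]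
          omega)
        simp [Fin.le_def] at hk
      · have : leftEnd σ l i + l i = 1 := by
          unfold leftEnd
          rw [add_comm, ← Finset.sum_insert (by simp), ← hs]
          congr 1
          ext j
          simp only [Finset.mem_filter, Finset.mem_univ, true_and, Finset.mem_insert,
            Fin.lt_def, ← σ.injective.eq_iff (a := j), Fin.ext_iff, iff_true]
          have := (σ j).isLt
          omega
        linarith
    refine ⟨⟨i, x - leftEnd σ l i, by linarith, by linarith⟩, ?_⟩
    apply Subtype.ext
    simp [tileFun]

/-- The tiling of `[0,1)` by intervals of lengths `l` in the order given by `σ`. -/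
def tile (hl : ∀ i, 0 < l i) (hs : ∑ i, l i = 1) :
    (Σ i : Fin n, Set.Ico (0 : ℝ) (l i)) ≃ Set.Ico (0 : ℝ) 1 :=
  Equiv.ofBijective (tileFun σ l hl hs) (tileFun_bijective σ l hl hs)

end Tiling

namespace IET

/-- The transformation of `[0,1)`: the `i`-th interval of the tiling in the natural order is
translated onto the `i`-th interval of the tiling in the order given by the permutation. -/
def toPerm (T : IET) : Equiv.Perm (Set.Ico (0 : ℝ) 1) :=
  (tile 1 T.len T.len_pos T.len_sum).symm.trans (tile T.perm T.len T.len_pos T.len_sum)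

/-- On the `i`-th interval, an IET is the translation by its `i`-th translation length. -/
theorem toPerm_apply (T : IET) (i : Fin T.n) (x : Set.Ico (0 : ℝ) 1)
    (h₀ : leftEnd 1 T.len i ≤ x) (h₁ : (x : ℝ) < leftEnd 1 T.len i + T.len i) :
    (T.toPerm x : ℝ) = x + translationLength T.perm T.len i := by
  have hx : (tile 1 T.len T.len_pos T.len_sum).symm x =
      ⟨i, x - leftEnd 1 T.len i, by linarith, by linarith⟩ := by
    rw [Equiv.symm_apply_eq]
    apply Subtype.ext
    simp [tile, tileFun]
  simp only [toPerm, Equiv.trans_apply, hx]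
  simp only [tile, tileFun, Equiv.ofBijective_apply, translationLength]
  ring

/-- The underlying permutation `π(T)`, an element of the disjoint union of the symmetric groups. -/
def type (T : IET) : Σ n : ℕ, Equiv.Perm (Fin n) := ⟨T.n, T.perm⟩

/-- The set `Δ(T)` of discontinuity points of `T`: the left endpoints `b_1 < … < b_{n-1}` of all
its intervals but the first one. -/
def disc (T : IET) : Set ℝ :=
  {x | ∃ i : Fin T.n, 0 < (i : ℕ) ∧ x = leftEnd 1 T.len i}

/-- All discontinuities are rational with denominator `q`. -/
def IsQRational (q : ℕ) (T : IET) : Prop :=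
  ∀ x ∈ T.disc, ∃ p : ℤ, x = p / q

/-- `T` is rational if it is `q`-rational for some positive integer `q`. -/
def IsRational (T : IET) : Prop :=
  ∃ q : ℕ, 0 < q ∧ T.IsQRational q

open Classical in
/-- The distance between IETs: the `ℓ¹` distance of the lengths if the permutations coincide,
and `∞` otherwise. -/
instance : EDist IET where
  edist S T :=
    if h : S.type = T.type then
      ENNReal.ofReal (∑ i, |S.len i - T.len (Fin.cast (congrArg Sigma.fst h) i)|)
    else ⊤

/-- The distance between two IETs with the same permutation. -/
theorem edist_mk {n : ℕ} {σ : Equiv.Perm (Fin n)} {l l' : Fin n → ℝ} (h₁ h₂ h₃ h₁' h₂' h₃') :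
    edist (IET.mk n σ l h₁ h₂ h₃) (IET.mk n σ l' h₁' h₂' h₃') =
      ENNReal.ofReal (∑ i, |l i - l' i|) := by
  simp [edist, type]

theorem edist_of_type_ne {S T : IET} (h : S.type ≠ T.type) : edist S T = ⊤ := by
  simp [edist, h]

instance : EMetricSpace IET where
  edist_self := by
    rintro ⟨n, σ, l, _, _, _⟩
    simp [edist_mk]
  edist_comm := by
    intro S T
    by_cases h : S.type = T.type
    · obtain ⟨n, σ, l, _, _, _⟩ := S
      obtain ⟨n', σ', l', _, _, _⟩ := T
      cases h
      simp [edist_mk, abs_sub_comm]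
    · rw [edist_of_type_ne h, edist_of_type_ne (Ne.symm h)]
  edist_triangle := by
    intro S T R
    by_cases h : S.type = T.type
    · by_cases h' : T.type = R.type
      · obtain ⟨n, σ, l, _, _, _⟩ := S
        obtain ⟨n', σ', l', _, _, _⟩ := T
        obtain ⟨n'', σ'', l'', _, _, _⟩ := R
        cases h
        cases h'
        rw [edist_mk, edist_mk, edist_mk, ← ENNReal.ofReal_add (by positivity) (by positivity),
          ← Finset.sum_add_distrib]
        exact ENNReal.ofReal_le_ofReal (Finset.sum_le_sum fun i _ => abs_sub_le _ _ _)
      · simp [edist_of_type_ne h']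
    · simp [edist_of_type_ne h]
  eq_of_edist_eq_zero := by
    intro S T h0
    by_cases h : S.type = T.type
    · obtain ⟨n, σ, l, _, _, _⟩ := S
      obtain ⟨n', σ', l', _, _, _⟩ := T
      cases h
      rw [edist_mk, ENNReal.ofReal_eq_zero] at h0
      have h1 := (Finset.sum_eq_zero_iff_of_nonneg (fun i _ => abs_nonneg (l i - l' i))).1
        (le_antisymm h0 (Finset.sum_nonneg fun i _ => abs_nonneg _))
      obtain rfl : l = l' := by
        funext i
        simpa [sub_eq_zero] using h1 i (Finset.mem_univ i)
      rfl
    · simp [edist_of_type_ne h] at h0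

end IET

/-- The word `[u, t^k u t^{-k}]` with `u = [t^{q!}, r t^{q!} r⁻¹]`, evaluated in a group. -/
def driftWord {G : Type*} [Group G] (q k : ℕ) (r t : G) : G :=
  ⁅⁅t ^ q.factorial, r * t ^ q.factorial * r⁻¹⁆,
    t ^ k * ⁅t ^ q.factorial, r * t ^ q.factorial * r⁻¹⁆ * (t ^ k)⁻¹⁆

end

/-! Write `N` for `q!`. The map `T₀` permutes the `q` cells `[i/q, (i+1)/q)` by translations, so
`T₀^N = id`. Let `T` be close to `T₀` with all translation lengths slightly larger. Away from the
cell ends, `T^N` is then a small translation to the right (`exists_translatesCores`).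

For any `R`, the conjugate `R T^N R⁻¹` is also a small local translation, except near finitely many
points modulo `ℤ/q`, the marks of `R`. Small translations commute, so `U = [T^N, R T^N R⁻¹]` is
supported near the marks (`commutator_conj_apply_eq_self`).

Modulo `ℤ/q`, `T` pushes every point to the right, at speeds whose ratios are bounded by a constant
`K` (`exists_int_drift`). Differences of marks avoid a whole window of sizes `[ρ, 6Kρ]` modulo `1`,
after scaling by `q` (`exists_separation_scale`). A suitable `T^k` has its displacement well inside
this window, so it moves the support of `U` off itself, and `U` commutes with `T^k U T^{-k}`.

The word is non-trivial because it survives in some `SL(2, ℤ/p)`. Counting homomorphisms to that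
finite group shows that a pair killing the word cannot generate a free group of rank 2. -/

section Word

/-! ### Non-triviality of the word and its consequence for freeness. -/

theorem map_driftWord {G H : Type*} [Group G] [Group H] (f : G →* H) (q k : ℕ) (r t : G) :
    f (driftWord q k r t) = driftWord q k (f r) (f t) := by
  simp [driftWord, map_commutatorElement]

theorem SL2_unipotent_pow {A : Type*} [CommRing A] (t : Matrix.SpecialLinearGroup (Fin 2) A)
    (ht : (t : Matrix (Fin 2) (Fin 2) A) = !![1, 1; 0, 1]) (m : ℕ) :
    ((t ^ m : Matrix.SpecialLinearGroup (Fin 2) A) : Matrix (Fin 2) (Fin 2) A) =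
      !![1, (m : A); 0, 1] := by
  induction m with
  | zero => simp [Matrix.one_fin_two]
  | succ m ih =>
    rw [pow_succ, Matrix.SpecialLinearGroup.coe_mul, ih, ht]
    simp [add_comm]

/-- The drift word takes a non-trivial value in some finite group, namely `SL(2, ℤ/p)` for a large
prime `p`. -/
theorem exists_finite_driftWord_ne_one (q k : ℕ) (hk : 0 < k) :
    ∃ (G : Type) (_ : Group G) (_ : Finite G) (r t : G), driftWord q k r t ≠ 1 := by
  obtain ⟨p, hple, hp⟩ := Nat.exists_infinite_primes (2 * k * q.factorial + 1)
  have : Fact p.Prime := ⟨hp⟩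
  set N := q.factorial with hN
  have hN0 : 0 < N := Nat.factorial_pos q
  have hne : ∀ m : ℕ, 0 < m → m ≤ 2 * k * N → (m : ZMod p) ≠ 0 := by
    intro m h0 h1 h
    rw [ZMod.natCast_eq_zero_iff] at h
    have := Nat.le_of_dvd h0 h
    omega
  have hkp : ((2 * k : ℕ) : ZMod p) ≠ 0 := hne (2 * k) (by omega) (Nat.le_mul_of_pos_right _ hN0)
  have hNp : (N : ZMod p) ≠ 0 := hne N hN0 (Nat.le_mul_of_pos_left N (by omega))
  let t : Matrix.SpecialLinearGroup (Fin 2) (ZMod p) := ⟨!![1, 1; 0, 1], by simp⟩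
  let r : Matrix.SpecialLinearGroup (Fin 2) (ZMod p) := ⟨!![0, -1; 1, 0], by simp⟩
  refine ⟨Matrix.SpecialLinearGroup (Fin 2) (ZMod p), inferInstance, inferInstance, r, t, ?_⟩
  intro h
  have hpow := SL2_unipotent_pow t rfl
  rw [driftWord, commutatorElement_eq_one_iff_mul_comm, ← hN] at h
  have h' := congrArg (fun g : Matrix.SpecialLinearGroup (Fin 2) (ZMod p) =>
    (g : Matrix (Fin 2) (Fin 2) (ZMod p)) 1 0) h
  have hr : (r : Matrix (Fin 2) (Fin 2) (ZMod p)) = !![0, -1; 1, 0] := rfl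
  simp only [commutatorElement_def, Matrix.SpecialLinearGroup.coe_mul,
    Matrix.SpecialLinearGroup.coe_inv, hpow, hr, Matrix.adjugate_fin_two_of, Matrix.mul_fin_two,
    mul_inv_rev, inv_inv, Matrix.of_apply, Matrix.cons_val_zero, Matrix.cons_val_one] at h'
  -- The lower left entries of the two products differ by `2kN⁶`, and `p > 2kN` makes both `2k` and
  -- `N` nonzero modulo `p`.
  have h0 : ((2 * k : ℕ) : ZMod p) * (N : ZMod p) ^ 6 = 0 := by
    push_cast
    linear_combination h'
  exact mul_ne_zero hkp (pow_ne_zero 6 hNp) h0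

theorem driftWord_freeGroup_ne_one (q k : ℕ) (hk : 0 < k) :
    driftWord q k (FreeGroup.of (0 : Fin 2)) (FreeGroup.of (1 : Fin 2)) ≠ 1 := by
  obtain ⟨G, _, _, r, t, h⟩ := exists_finite_driftWord_ne_one q k hk
  intro h1
  apply h
  have := congrArg (FreeGroup.lift ![r, t]) h1
  simpa [map_driftWord] using this

/-- A free group of rank `2` has no generating pair satisfying the drift word: homomorphisms from
it to a finite group `G` are as many as pairs in `G`, so every pair in `G` is the image of the
generating pair. -/
theorem closure_pair_not_free {H : Type*} [Group H] (q k : ℕ) (hk : 0 < k) (r t : H)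
    (hw : driftWord q k r t = 1) :
    ¬ Nonempty (Subgroup.closure {r, t} ≃* FreeGroup (Fin 2)) := by
  rintro ⟨e⟩
  obtain ⟨G, _, _, a, b, h⟩ := exists_finite_driftWord_ne_one q k hk
  let r' : Subgroup.closure {r, t} := ⟨r, Subgroup.subset_closure (by simp)⟩
  let t' : Subgroup.closure {r, t} := ⟨t, Subgroup.subset_closure (by simp)⟩
  have hw' : driftWord q k r' t' = 1 := by
    apply (Subgroup.closure {r, t}).subtype_injective
    rw [map_driftWord, map_one]
    exact hw
  let E : (Fin 2 → G) ≃ (Subgroup.closure {r, t} →* G) :=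
    FreeGroup.lift.trans
      { toFun := fun f => f.comp e.toMonoidHom
        invFun := fun f => f.comp e.symm.toMonoidHom
        left_inv := fun f => by ext; simp
        right_inv := fun f => by ext; simp }
  let ev : (Subgroup.closure {r, t} →* G) → (Fin 2 → G) := fun f => ![f r', f t']
  have hinj : Function.Injective ev := by
    intro f g hfg
    have h0 : f r' = g r' := congrFun hfg 0
    have h1 : f t' = g t' := congrFun hfg 1
    refine MonoidHom.ext ?_
    rintro ⟨x, hx⟩
    induction hx using Subgroup.closure_induction with
    | mem x hx =>
      rcases hx with rfl | rfl
      · exact h0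
      · exact h1
    | one => exact (map_one f).trans (map_one g).symm
    | mul x y hx hy ihx ihy =>
      have := congrArg₂ (· * ·) ihx ihy
      exact (map_mul f ⟨x, hx⟩ ⟨y, hy⟩).trans (this.trans (map_mul g ⟨x, hx⟩ ⟨y, hy⟩).symm)
    | inv x hx ih =>
      have := congrArg (·⁻¹) ih
      exact (map_inv f ⟨x, hx⟩).trans (this.trans (map_inv g ⟨x, hx⟩).symm)
  have hsurj : Function.Surjective (ev ∘ E) :=
    Finite.surjective_of_injective (hinj.comp E.injective)
  obtain ⟨v, hv⟩ := hsurj ![a, b]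
  have h0 : E v r' = a := congrFun hv 0
  have h1 : E v t' = b := congrFun hv 1
  apply h
  rw [← h0, ← h1, ← map_driftWord, hw', map_one]

end Word

/-! ### Commutation of local translations. -/

section Commutator

/-- Two bijections that are translations to the right near and to the left of `x` commute there. -/
theorem commutator_apply_eq_self (A B : Equiv.Perm (Set.Ico (0 : ℝ) 1)) (x : Set.Ico (0 : ℝ) 1)
    {a b : ℝ} (ha : 0 ≤ a) (hb : 0 ≤ b) (h0 : 0 ≤ (x : ℝ) - a - b)
    (hA : ∀ z : Set.Ico (0 : ℝ) 1, (x : ℝ) - a - b ≤ z → (z : ℝ) ≤ x → (A z : ℝ) = z + a)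
    (hB : ∀ z : Set.Ico (0 : ℝ) 1, (x : ℝ) - a - b ≤ z → (z : ℝ) ≤ x → (B z : ℝ) = z + b) :
    ⁅A, B⁆ x = x := by
  have hx1 : (x : ℝ) < 1 := x.2.2
  -- The commutator walks around the parallelogram `x`, `x - b`, `x - a - b`, `x - a`, `x`.
  let y₁ : Set.Ico (0 : ℝ) 1 := ⟨x - b, by linarith, by linarith⟩
  let y₂ : Set.Ico (0 : ℝ) 1 := ⟨x - a - b, by linarith, by linarith⟩
  let y₃ : Set.Ico (0 : ℝ) 1 := ⟨x - a, by linarith, by linarith⟩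
  have e₁ : B y₁ = x := Subtype.ext (by
    rw [hB y₁ (by simp only [y₁]; linarith) (by simp only [y₁]; linarith)]
    simp only [y₁]; ring)
  have e₂ : A y₂ = y₁ := Subtype.ext (by
    rw [hA y₂ (by simp only [y₂]; linarith) (by simp only [y₂]; linarith)]
    simp only [y₁, y₂]; ring)
  have e₃ : B y₂ = y₃ := Subtype.ext (by
    rw [hB y₂ (by simp only [y₂]; linarith) (by simp only [y₂]; linarith)]
    simp only [y₂, y₃]; ring)
  have e₄ : A y₃ = x := Subtype.ext (by
    rw [hA y₃ (by simp only [y₃]; linarith) (by simp only [y₃]; linarith)]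
    simp only [y₃]; ring)
  have i₁ : B⁻¹ x = y₁ := by rw [Equiv.Perm.inv_eq_iff_eq, e₁]
  have i₂ : A⁻¹ y₁ = y₂ := by rw [Equiv.Perm.inv_eq_iff_eq, e₂]
  simp only [commutatorElement_def, Equiv.Perm.mul_apply]
  rw [i₁, i₂, e₃, e₄]

end Commutator

/-! ### The grid `ℤ/q` and the support of the commutator. -/

section Grid

/-- `y` is at distance at least `ρ` from the integers. -/
def FarFromInt (ρ y : ℝ) : Prop := ∀ m : ℤ, ρ ≤ |y - m|

theorem FarFromInt.fract {ρ y : ℝ} (h : FarFromInt ρ y) :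
    ρ ≤ Int.fract y ∧ Int.fract y ≤ 1 - ρ := by
  have h0 := h ⌊y⌋
  have h1 := h (⌊y⌋ + 1)
  rw [Int.self_sub_floor, abs_of_nonneg (Int.fract_nonneg y)] at h0
  have e : y - ((⌊y⌋ + 1 : ℤ) : ℝ) = Int.fract y - 1 := by
    push_cast
    rw [← Int.self_sub_floor]; ring
  rw [e, abs_of_nonpos (by linarith [Int.fract_lt_one y])] at h1
  exact ⟨h0, by linarith⟩

theorem FarFromInt.mono {ρ ρ' y y' : ℝ} (h : FarFromInt ρ y) (hy : |y - y'| ≤ ρ - ρ') :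
    FarFromInt ρ' y' := by
  intro m
  have h1 := h m
  have h2 := abs_sub_le y y' m
  linarith

theorem exists_fin_add_fract {q : ℕ} (hq : 0 < q) (x : Set.Ico (0 : ℝ) 1) :
    ∃ i : Fin q, (q : ℝ) * x = i + Int.fract (q * (x : ℝ)) := by
  have hq' : (0 : ℝ) < q := by exact_mod_cast hq
  have h0 : 0 ≤ ⌊(q : ℝ) * x⌋ := Int.floor_nonneg.2 (mul_nonneg hq'.le x.2.1)
  have h1 : ⌊(q : ℝ) * x⌋ < q := by
    rw [Int.floor_lt]
    have := mul_lt_mul_of_pos_left x.2.2 hq'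
    push_cast
    linarith
  obtain ⟨m, hm⟩ := Int.eq_ofNat_of_zero_le h0
  refine ⟨⟨m, by omega⟩, ?_⟩
  have : ((⌊(q : ℝ) * x⌋ : ℤ) : ℝ) = m := by rw [hm]; simp
  rw [← Int.self_sub_floor, this]
  simp

/-- `A` translates the core of each interval `[i/q, (i+1)/q)` by `D i`, which is small. -/
def TranslatesCores (q : ℕ) (c : ℝ) (D : Fin q → ℝ) (A : Equiv.Perm (Set.Ico (0 : ℝ) 1)) : Prop :=
  (∀ i, 0 ≤ D i ∧ q * D i ≤ c) ∧
    ∀ (i : Fin q) (s : ℝ) (x : Set.Ico (0 : ℝ) 1), c ≤ s → s ≤ 1 - c → (q : ℝ) * x = i + s →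
      (A x : ℝ) = x + D i

end Grid

namespace IET

/-- The points, modulo `ℤ/q`, near which an IET fails to conjugate small local translations to
translations: ends of images of intervals, translation lengths and `0`. -/
def mark {n : ℕ} (σ : Equiv.Perm (Fin n)) (l : Fin n → ℝ) :
    (Fin n ⊕ Fin n) ⊕ (Fin n ⊕ Unit) → ℝ :=
  Sum.elim (Sum.elim (leftEnd σ l) fun j => leftEnd σ l j + l j)
    (Sum.elim (translationLength σ l) fun _ => 0)

theorem exists_mem_interval (T : IET) (x : Set.Ico (0 : ℝ) 1) :
    ∃ i : Fin T.n, leftEnd 1 T.len i ≤ x ∧ (x : ℝ) < leftEnd 1 T.len i + T.len i := by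
  obtain ⟨⟨i, s, h0, h1⟩, h⟩ := (tileFun_bijective 1 T.len T.len_pos T.len_sum).2 x
  have h' : leftEnd 1 T.len i + s = x := congrArg Subtype.val h
  exact ⟨i, by linarith, by linarith⟩

/-- The ends of images keep `w = R⁻¹x` well inside its interval of continuity; the mark `0` and the
translation lengths keep `x` and `w` well inside grid cells. At scale `q` each of the two
translations is at most `c`, so the margin `4c` contains the whole range from `x - a - b` to `x` on
which both maps must act as translations. -/
theorem commutator_conj_apply_eq_self {q : ℕ} (hq : 0 < q) {c : ℝ} (hc : 0 < c) {D : Fin q → ℝ}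
    {A : Equiv.Perm (Set.Ico (0 : ℝ) 1)} (hA : TranslatesCores q c D A) (R : IET)
    (x : Set.Ico (0 : ℝ) 1)
    (hx : ∀ m, FarFromInt (4 * c) (q * ((x : ℝ) - mark R.perm R.len m))) :
    ⁅A, R.toPerm * A * R.toPerm⁻¹⁆ x = x := by
  have hq' : (0 : ℝ) < q := by exact_mod_cast hq
  obtain ⟨w, rfl⟩ := R.toPerm.surjective x
  obtain ⟨j, hj0, hj1⟩ := R.exists_mem_interval w
  have hwx := R.toPerm_apply j w hj0 hj1
  set x := R.toPerm w with hxdef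
  set t := translationLength R.perm R.len j with ht
  set L := leftEnd 1 R.len j with hL
  set ℓ := R.len j with hℓ
  have htL : leftEnd R.perm R.len j = L + t := by rw [ht, translationLength, hL]; ring
  have hl : 4 * c ≤ q * ((w : ℝ) - L) := by
    have h := hx (Sum.inl (Sum.inl j)) 0
    simp only [mark, Sum.elim_inl, htL, hwx, Int.cast_zero, sub_zero] at h
    rw [abs_of_nonneg (mul_nonneg hq'.le (by linarith))] at h
    linarith
  have hr : q * ((w : ℝ) - (L + ℓ)) ≤ - (4 * c) := by
    have h := hx (Sum.inl (Sum.inr j)) 0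
    simp only [mark, Sum.elim_inl, Sum.elim_inr, htL, hwx, ← hℓ, Int.cast_zero, sub_zero] at h
    rw [abs_of_nonpos (mul_nonpos_of_nonneg_of_nonpos hq'.le (by linarith))] at h
    linarith
  have hwfar : FarFromInt (4 * c) (q * (w : ℝ)) := by
    have h := hx (Sum.inr (Sum.inl j))
    simp only [mark, Sum.elim_inl, Sum.elim_inr, hwx, ← ht] at h
    simpa using h
  have hxfar : FarFromInt (4 * c) (q * (x : ℝ)) := by
    have h := hx (Sum.inr (Sum.inr ()))
    simpa [mark] using h
  obtain ⟨i, hi⟩ := exists_fin_add_fract hq x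
  obtain ⟨i', hi'⟩ := exists_fin_add_fract hq w
  obtain ⟨hs0, hs1⟩ := hxfar.fract
  obtain ⟨hs0', hs1'⟩ := hwfar.fract
  set s := Int.fract (q * (x : ℝ))
  set s' := Int.fract (q * (w : ℝ))
  obtain ⟨ha0, ha1⟩ := hA.1 i
  obtain ⟨hb0, hb1⟩ := hA.1 i'
  have hL0 : 0 ≤ L := leftEnd_nonneg 1 R.len R.len_pos j
  have hL1 : L + ℓ ≤ 1 := leftEnd_add_le_one 1 R.len R.len_pos R.len_sum j
  have hab : q * (D i + D i') ≤ 2 * c := by linarith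
  have hi0 : (0 : ℝ) ≤ i := by positivity
  have hpos : ∀ y : ℝ, 0 ≤ q * y → 0 ≤ y := fun y h => nonneg_of_mul_nonneg_right h hq'
  refine commutator_apply_eq_self A _ x ha0 hb0 (hpos _ (by linarith)) ?_ ?_
  · intro z hz0 hz1
    have h0 := mul_le_mul_of_nonneg_left hz0 hq'.le
    have h1 := mul_le_mul_of_nonneg_left hz1 hq'.le
    exact hA.2 i (q * z - i) z (by linarith) (by linarith) (by ring)
  · intro z hz0 hz1
    have h0 := mul_le_mul_of_nonneg_left hz0 hq'.le
    have h1 := mul_le_mul_of_nonneg_left hz1 hq'.le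
    rw [hwx] at h0 h1
    have hzL : L ≤ z - t := by
      have := hpos (z - t - L) (by linarith)
      linarith
    have hzr : z - t + D i' < L + ℓ := by
      have := pos_of_mul_pos_right (a := (q : ℝ)) (b := L + ℓ - (z - t + D i')) (by linarith) hq'.le
      linarith
    let v : Set.Ico (0 : ℝ) 1 := ⟨z - t, by linarith, by linarith⟩
    have hv : R.toPerm v = z := Subtype.ext (by
      rw [R.toPerm_apply j v hzL (by simp only [v]; linarith)]
      simp only [v, ← ht]; ring)
    have hAv : (A v : ℝ) = z - t + D i' :=
      hA.2 i' (q * v - i') v (by simp only [v]; linarith) (by simp only [v]; linarith) (by ring)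
    rw [Equiv.Perm.mul_apply, Equiv.Perm.mul_apply, (Equiv.Perm.inv_eq_iff_eq).2 hv.symm,
      R.toPerm_apply j (A v) (by rw [hAv]; linarith) (by rw [hAv]; exact hzr), hAv, ← ht]
    ring

end IET

/-! ### Dependence of endpoints and translation lengths on the lengths. -/

section LeftEnd

variable {n : ℕ}

theorem leftEnd_one_succ (l : Fin n → ℝ) (i : Fin n) (h : (i : ℕ) + 1 < n) :
    leftEnd 1 l ⟨i + 1, h⟩ = leftEnd 1 l i + l i := by
  unfold leftEnd
  rw [add_comm (Finset.sum _ _), ← Finset.sum_insert (by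
    simp only [Finset.mem_filter, lt_irrefl, and_false, not_false_eq_true])]
  congr 1
  ext j
  simp only [Finset.mem_filter, Finset.mem_univ, true_and, Finset.mem_insert,
    Equiv.Perm.one_apply, Fin.lt_def, Fin.ext_iff]
  omega

theorem leftEnd_one_add_last (l : Fin n → ℝ) (i : Fin n) (h : ¬ (i : ℕ) + 1 < n) :
    leftEnd 1 l i + l i = ∑ j, l j := by
  unfold leftEnd
  rw [add_comm, ← Finset.sum_insert (by
    simp only [Finset.mem_filter, lt_irrefl, and_false, not_false_eq_true])]
  congr 1
  ext j
  simp only [Finset.mem_filter, Finset.mem_univ, true_and, Finset.mem_insert,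
    Equiv.Perm.one_apply, Fin.lt_def, Fin.ext_iff, iff_true]
  have := j.isLt
  omega

theorem leftEnd_add_smul (σ : Equiv.Perm (Fin n)) (l d : Fin n → ℝ) (s : ℝ) (i : Fin n) :
    leftEnd σ (fun j => l j + s * d j) i = leftEnd σ l i + s * leftEnd σ d i := by
  simp only [leftEnd, Finset.sum_add_distrib, Finset.mul_sum]

theorem translationLength_add_smul (σ : Equiv.Perm (Fin n)) (l d : Fin n → ℝ) (s : ℝ)
    (i : Fin n) :
    translationLength σ (fun j => l j + s * d j) i =
      translationLength σ l i + s * translationLength σ d i := by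
  simp only [translationLength, leftEnd_add_smul]
  ring

theorem continuous_leftEnd (σ : Equiv.Perm (Fin n)) (i : Fin n) :
    Continuous fun l : Fin n → ℝ => leftEnd σ l i := by
  unfold leftEnd
  fun_prop

theorem continuous_translationLength (σ : Equiv.Perm (Fin n)) (i : Fin n) :
    Continuous fun l : Fin n → ℝ => translationLength σ l i :=
  (continuous_leftEnd σ i).sub (continuous_leftEnd 1 i)

theorem exists_int_leftEnd {q : ℕ} {l : Fin n → ℝ} (hl : ∀ i, ∃ m : ℤ, q * l i = m)
    (σ : Equiv.Perm (Fin n)) (i : Fin n) : ∃ m : ℤ, q * leftEnd σ l i = m := by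
  choose f hf using hl
  refine ⟨∑ j with σ j < σ i, f j, ?_⟩
  simp [leftEnd, Finset.mul_sum, hf]

theorem exists_int_translationLength {q : ℕ} {l : Fin n → ℝ} (hl : ∀ i, ∃ m : ℤ, q * l i = m)
    (σ : Equiv.Perm (Fin n)) (i : Fin n) : ∃ m : ℤ, q * translationLength σ l i = m := by
  obtain ⟨a, ha⟩ := exists_int_leftEnd hl σ i
  obtain ⟨b, hb⟩ := exists_int_leftEnd hl 1 i
  refine ⟨a - b, ?_⟩
  rw [translationLength, mul_sub, ha, hb]
  push_cast
  ring

end LeftEnd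

namespace IET

theorem IsQRational.exists_int_len {q : ℕ} (hq : 0 < q) {T : IET} (hT : T.IsQRational q)
    (i : Fin T.n) : ∃ m : ℤ, q * T.len i = m := by
  have hq' : (q : ℝ) ≠ 0 := by exact_mod_cast hq.ne'
  have hleft : ∀ j : Fin T.n, ∃ m : ℤ, q * leftEnd 1 T.len j = m := by
    intro j
    rcases Nat.eq_zero_or_pos (j : ℕ) with h | h
    · refine ⟨0, ?_⟩
      have : leftEnd 1 T.len j = 0 := by
        unfold leftEnd
        apply Finset.sum_eq_zero
        intro k hk
        simp [Fin.lt_def, h] at hk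
      simp [this]
    · obtain ⟨p, hp⟩ := hT _ ⟨j, h, rfl⟩
      exact ⟨p, by rw [hp]; field_simp⟩
  obtain ⟨a, ha⟩ := hleft i
  by_cases h : (i : ℕ) + 1 < T.n
  · obtain ⟨b, hb⟩ := hleft ⟨i + 1, h⟩
    rw [leftEnd_one_succ] at hb
    refine ⟨b - a, ?_⟩
    push_cast
    linarith
  · have hb := leftEnd_one_add_last T.len i h
    rw [T.len_sum] at hb
    refine ⟨q - a, ?_⟩
    push_cast
    rw [← ha]
    linear_combination (q : ℝ) * hb

/-! ### Dynamics of perturbations of a `q`-rational IET. -/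

section Perturbation

variable {n q : ℕ} {σ : Equiv.Perm (Fin n)} {l₀ l : Fin n → ℝ}

/-- An IET close to a `q`-rational one, with larger translation lengths, has a power that translates
the cores of the intervals `[i/q, (i+1)/q)`. -/
theorem exists_translatesCores (hq : 0 < q) (h₁ : ∀ i, 0 < l₀ i) (h₂ : ∑ i, l₀ i = 1)
    (h₃ : ∀ i j : Fin n, (j : ℕ) = i + 1 → (σ j : ℕ) ≠ σ i + 1)
    (h₁' : ∀ i, 0 < l i) (h₂' : ∑ i, l i = 1)
    (hrat : ∀ i, ∃ m : ℤ, q * l₀ i = m) {η c : ℝ} (hη : 0 < η) (hc : (q.factorial + 1) * η ≤ c)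
    (hleft : ∀ i, |q * (leftEnd 1 l i - leftEnd 1 l₀ i)| < η)
    (hright : ∀ i, |q * ((leftEnd 1 l i + l i) - (leftEnd 1 l₀ i + l₀ i))| < η)
    (hτ : ∀ i, 0 ≤ q * (translationLength σ l i - translationLength σ l₀ i) ∧
      q * (translationLength σ l i - translationLength σ l₀ i) ≤ η) :
    ∃ D, TranslatesCores q c D ((IET.mk n σ l h₁' h₂' h₃).toPerm ^ q.factorial) := by
  have hq' : (0 : ℝ) < q := by exact_mod_cast hq
  set T := IET.mk n σ l h₁' h₂' h₃ with hT
  let T₀ := IET.mk n σ l₀ h₁ h₂ h₃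
  choose mL hmL using exists_int_leftEnd hrat 1
  choose ml hml using hrat
  choose mt hmt using exists_int_translationLength (fun i => ⟨ml i, hml i⟩) σ
  let pt : Fin q → Set.Ico (0 : ℝ) 1 := fun i => ⟨i / q, by positivity, by
    rw [div_lt_one hq']
    exact_mod_cast i.2⟩
  have hpt : ∀ i, q * (pt i : ℝ) = i := fun i => by
    simp only [pt]
    field_simp
  -- `J i` is the interval of `T₀` containing the cell `i`, and `π` is the permutation of cells
  -- induced by `T₀`.
  choose J hJ0 hJ1 using fun i => T₀.exists_mem_interval (pt i)
  have hT₀ : ∀ i, q * (T₀.toPerm (pt i) : ℝ) = ((i + mt (J i) : ℤ) : ℝ) := by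
    intro i
    rw [T₀.toPerm_apply (J i) (pt i) (hJ0 i) (hJ1 i), mul_add, hpt]
    push_cast
    rw [← hmt]
  have hrange : ∀ i : Fin q, 0 ≤ (i : ℤ) + mt (J i) ∧ (i : ℤ) + mt (J i) < q := by
    intro i
    have h0 := mul_nonneg hq'.le (T₀.toPerm (pt i)).2.1
    have h1 := mul_lt_mul_of_pos_left (T₀.toPerm (pt i)).2.2 hq'
    rw [hT₀] at h0 h1
    rw [mul_one] at h1
    constructor
    · exact_mod_cast h0
    · exact_mod_cast h1
  let π₀ : Fin q → Fin q := fun i => ⟨((i : ℤ) + mt (J i)).toNat, by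
    have := hrange i
    omega⟩
  have hπ₀ : ∀ i, ((π₀ i : ℕ) : ℤ) = i + mt (J i) := fun i => Int.toNat_of_nonneg (hrange i).1
  have hinj : Function.Injective π₀ := by
    intro i i' h
    have h1 : (T₀.toPerm (pt i) : ℝ) = T₀.toPerm (pt i') := by
      apply mul_left_cancel₀ hq'.ne'
      rw [hT₀, hT₀, ← hπ₀, ← hπ₀, h]
    have h2 := congrArg (fun x : Set.Ico (0 : ℝ) 1 => q * (x : ℝ))
      (T₀.toPerm.injective (Subtype.ext h1))
    simp only [hpt] at h2
    exact Fin.ext (by exact_mod_cast h2)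
  let π : Equiv.Perm (Fin q) := Equiv.ofBijective π₀ (Finite.injective_iff_bijective.1 hinj)
  have hπ : ∀ i, ((π i : ℕ) : ℝ) = i + mt (J i) := fun i => by
    have := hπ₀ i
    exact_mod_cast this
  let τ : Fin q → ℝ := fun i =>
    translationLength σ l (J i) - translationLength σ l₀ (J i)
  have step : ∀ (i : Fin q) (s : ℝ) (x : Set.Ico (0 : ℝ) 1), η ≤ s → s ≤ 1 - η →
      (q : ℝ) * x = i + s → q * (T.toPerm x : ℝ) = (π i : ℕ) + (s + q * τ i) := by
    intro i s x hs0 hs1 hx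
    -- The endpoints of `T₀` are integers at scale `q`, so its interval containing `i/q` contains
    -- the whole cell.
    have hL : mL (J i) ≤ (i : ℤ) := by
      have := mul_le_mul_of_nonneg_left (hJ0 i) hq'.le
      rw [hpt] at this
      have h := hmL (J i)
      have : ((mL (J i) : ℤ) : ℝ) ≤ i := by rw [← h]; exact this
      exact_mod_cast this
    have hR : (i : ℤ) + 1 ≤ mL (J i) + ml (J i) := by
      have := mul_lt_mul_of_pos_left (hJ1 i) hq'
      rw [hpt, mul_add] at this
      have h := hmL (J i)
      have h' := hml (J i)
      have : (i : ℝ) < (mL (J i) : ℤ) + (ml (J i) : ℤ) := by rw [← h, ← h']; exact this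
      have : (i : ℤ) < mL (J i) + ml (J i) := by exact_mod_cast this
      omega
    have hL' : ((mL (J i) : ℤ) : ℝ) ≤ i := by exact_mod_cast hL
    have hR' : (i : ℝ) + 1 ≤ (mL (J i) : ℤ) + (ml (J i) : ℤ) := by exact_mod_cast hR
    have e0 := abs_lt.1 (hleft (J i))
    have e1 := abs_lt.1 (hright (J i))
    rw [mul_sub, hmL] at e0
    rw [mul_sub, mul_add (q : ℝ) (leftEnd 1 l₀ _), hmL, hml] at e1
    have hx0 : leftEnd 1 T.len (J i) ≤ x :=
      le_of_mul_le_mul_left (a := (q : ℝ)) (by rw [hx]; linarith [e0.2]) hq'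
    have hx1 : (x : ℝ) < leftEnd 1 T.len (J i) + T.len (J i) :=
      lt_of_mul_lt_mul_left (a := (q : ℝ)) (by rw [hx]; linarith [e1.1]) hq'.le
    rw [T.toPerm_apply (J i) x hx0 hx1, mul_add, hx, hπ, ← hmt]
    simp only [τ]
    ring
  have hτ0 : ∀ i, 0 ≤ q * τ i := fun i => (hτ (J i)).1
  have hτ1 : ∀ i, q * τ i ≤ η := fun i => (hτ (J i)).2
  have hsum0 : ∀ (m : ℕ) i, 0 ≤ q * ∑ k ∈ Finset.range m, τ ((π ^ k) i) := fun m i => by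
    rw [Finset.mul_sum]
    exact Finset.sum_nonneg fun k _ => hτ0 _
  have hsum1 : ∀ (m : ℕ) i, q * ∑ k ∈ Finset.range m, τ ((π ^ k) i) ≤ m * η := fun m i => by
    rw [Finset.mul_sum]
    refine (Finset.sum_le_card_nsmul _ _ η fun k _ => hτ1 _).trans ?_
    simp
  -- Offsets inside cells never decrease and grow by at most `η` per step. Thus `s + mη ≤ 1` keeps
  -- the offset at most `1 - η` before each of the `m` steps.
  have iter : ∀ (m : ℕ) (i : Fin q) (s : ℝ) (x : Set.Ico (0 : ℝ) 1), η ≤ s →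
      s + m * η ≤ 1 → (q : ℝ) * x = i + s → q * ((T.toPerm ^ m) x : ℝ) =
        ((π ^ m) i : ℕ) + (s + q * ∑ k ∈ Finset.range m, τ ((π ^ k) i)) := by
    intro m
    induction m with
    | zero => intro i s x _ _ hx; simpa using hx
    | succ m ih =>
      intro i s x hs0 hs1 hx
      push_cast at hs1
      have h := ih i s x hs0 (by linarith) hx
      have h0 := hsum0 m i
      have h1 := hsum1 m i
      rw [pow_succ', Equiv.Perm.mul_apply, step _ _ _ (by linarith) (by linarith) h,
        Finset.sum_range_succ, pow_succ', Equiv.Perm.mul_apply]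
      ring
  have hπfac : π ^ q.factorial = 1 := by
    have := pow_card_eq_one (x := π)
    rwa [Fintype.card_perm, Fintype.card_fin] at this
  have hfac : (q.factorial : ℝ) * η ≤ c := by linarith
  have hηc : η ≤ c := by
    have : 0 ≤ (q.factorial : ℝ) * η := by positivity
    linarith
  refine ⟨fun i => ∑ k ∈ Finset.range q.factorial, τ ((π ^ k) i), fun i => ⟨?_, ?_⟩, ?_⟩
  · exact nonneg_of_mul_nonneg_right (hsum0 _ i) hq'
  · exact (hsum1 _ i).trans hfac
  · intro i s x hs0 hs1 hx
    have h := iter q.factorial i s x (by linarith) (by linarith) hx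
    rw [hπfac, Equiv.Perm.one_apply] at h
    apply mul_left_cancel₀ hq'.ne'
    rw [h, mul_add, hx]
    ring

/-- Modulo `ℤ/q`, an IET with larger translation lengths than a `q`-rational one moves every point
to the right. -/
theorem exists_int_drift (h₃ : ∀ i j : Fin n, (j : ℕ) = i + 1 → (σ j : ℕ) ≠ σ i + 1)
    (h₁' : ∀ i, 0 < l i) (h₂' : ∑ i, l i = 1)
    (hrat : ∀ i, ∃ m : ℤ, q * l₀ i = m) {δ δ' : ℝ}
    (hτ : ∀ i, δ ≤ q * (translationLength σ l i - translationLength σ l₀ i) ∧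
      q * (translationLength σ l i - translationLength σ l₀ i) ≤ δ')
    (k : ℕ) (x : Set.Ico (0 : ℝ) 1) :
    ∃ m : ℤ, k * δ ≤ q * ((((IET.mk n σ l h₁' h₂' h₃).toPerm ^ k) x : ℝ) - x) - m ∧
      q * ((((IET.mk n σ l h₁' h₂' h₃).toPerm ^ k) x : ℝ) - x) - m ≤ k * δ' := by
  set T := IET.mk n σ l h₁' h₂' h₃ with hT
  induction k with
  | zero => exact ⟨0, by simp⟩
  | succ k ih =>
    obtain ⟨m, hm0, hm1⟩ := ih
    obtain ⟨j, hj0, hj1⟩ := T.exists_mem_interval ((T.toPerm ^ k) x)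
    -- Translation lengths computed from `l₀` lie in `ℤ/q`, so modulo `ℤ/q` only their excess in `l`
    -- is seen.
    obtain ⟨p, hp⟩ := exists_int_translationLength hrat σ j
    obtain ⟨h0, h1⟩ := hτ j
    refine ⟨m + p, ?_⟩
    have e : q * (((T.toPerm ^ (k + 1)) x : ℝ) - x) - ((m + p : ℤ) : ℝ) =
        (q * (((T.toPerm ^ k) x : ℝ) - x) - m) +
          q * (translationLength σ l j - translationLength σ l₀ j) := by
      rw [pow_succ', Equiv.Perm.mul_apply, T.toPerm_apply j _ hj0 hj1]
      push_cast
      rw [← hp]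
      simp only [hT]
      ring
    rw [e, Nat.cast_succ]
    constructor <;> linarith

end Perturbation

/-- If a power of `t` pushes a neighbourhood of the marks off itself, the drift word vanishes. -/
theorem driftWord_eq_one_of_drift {q k : ℕ} (hq : 0 < q) {c K : ℝ} (hc : 0 < c) (hK : 1 ≤ K)
    {D : Fin q → ℝ} {t : Equiv.Perm (Set.Ico (0 : ℝ) 1)}
    (hA : TranslatesCores q c D (t ^ q.factorial)) (R : IET)
    (f : (Fin R.n ⊕ Fin R.n) ⊕ (Fin R.n ⊕ Unit) → ℝ)
    (hf : ∀ a, |q * (mark R.perm R.len a - f a)| ≤ 4 * c)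
    (hsep : ∀ a b, ∀ m : ℤ,
      ¬ (8 * c ≤ q * (f a - f b) - m ∧ q * (f a - f b) - m ≤ 6 * K * (8 * c)))
    (hdrift : ∀ x, ∃ m : ℤ, 3 * (8 * c) ≤ q * (((t ^ k) x : ℝ) - x) - m ∧
      q * (((t ^ k) x : ℝ) - x) - m ≤ 4 * K * (8 * c)) :
    driftWord q k R.toPerm t = 1 := by
  have near : ∀ x, ⁅t ^ q.factorial, R.toPerm * t ^ q.factorial * R.toPerm⁻¹⁆ x ≠ x →
      ∃ a, ∃ m : ℤ, |q * ((x : ℝ) - f a) - m| < 8 * c := by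
    intro x hx
    by_contra! hcon
    refine hx (commutator_conj_apply_eq_self hq hc hA R x fun a => ?_)
    -- Marks of `R` are within `4c` of the reference points `f`, which costs half of the margin
    -- `8c`.
    refine FarFromInt.mono (ρ := 8 * c) (y := q * ((x : ℝ) - f a)) (hcon a) ?_
    have e : q * ((x : ℝ) - f a) - q * (x - mark R.perm R.len a) =
        q * (mark R.perm R.len a - f a) := by ring
    rw [e]
    linarith [hf a]
  rw [driftWord, commutatorElement_eq_one_iff_mul_comm]
  set u := ⁅t ^ q.factorial, R.toPerm * t ^ q.factorial * R.toPerm⁻¹⁆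
  refine Equiv.Perm.Disjoint.commute (fun x => ?_)
  by_contra! hcon
  obtain ⟨hx, hy⟩ := hcon
  obtain ⟨y, rfl⟩ := (t ^ k).surjective x
  have hy' : u y ≠ y := by
    intro h
    apply hy
    simp [Equiv.Perm.mul_apply, h]
  obtain ⟨a, m, ham⟩ := near _ hx
  obtain ⟨b, m', hbm⟩ := near _ hy'
  obtain ⟨p, hp0, hp1⟩ := hdrift y
  rw [abs_lt] at ham hbm
  have hKc : 8 * c ≤ K * (8 * c) := le_mul_of_one_le_left (by linarith) hK
  -- With `ρ = 8c`, a drift in `[3ρ, 4Kρ]` corrected by two errors below `ρ` lies in `[ρ, 6Kρ]`,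
  -- where no difference of reference points is allowed.
  refine hsep a b (p - m + m') ⟨?_, ?_⟩ <;> push_cast <;> linarith [ham.1, ham.2, hbm.1, hbm.2]

end IET

/-! ### Choice of the scale, open sets of IETs and drift directions. -/

open Filter in
/-- A finite set of reals is separated modulo `1` at all small scales. -/
theorem exists_separation_scale {ι : Type*} [Finite ι] (y : ι → ℝ) (C : ℝ) :
    ∃ ρ : ℝ, 0 < ρ ∧ ∀ a, ∀ m : ℤ, ¬ (ρ ≤ y a - m ∧ y a - m ≤ C * ρ) := by
  have htend : Tendsto (fun ρ : ℝ => C * ρ) (𝓝[>] 0) (𝓝 0) := by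
    have : Tendsto (fun ρ : ℝ => C * ρ) (𝓝 0) (𝓝 (C * 0)) :=
      (continuous_const.mul continuous_id).tendsto 0
    rw [mul_zero] at this
    exact this.mono_left nhdsWithin_le_nhds
  have hev : ∀ᶠ ρ in 𝓝[>] (0 : ℝ), 0 < ρ ∧ C * ρ < 1 ∧
      ∀ a, Int.fract (y a) ≠ 0 → C * ρ < Int.fract (y a) := by
    refine eventually_mem_nhdsWithin.and ((htend.eventually_lt_const one_pos).and ?_)
    rw [eventually_all]
    intro a
    by_cases h : Int.fract (y a) = 0
    · exact Eventually.of_forall fun _ h' => absurd h h'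
    · filter_upwards [htend.eventually_lt_const
        (lt_of_le_of_ne (Int.fract_nonneg _) (Ne.symm h))] with ρ hρ _ using hρ
  obtain ⟨ρ, hρ, hρ1, hρy⟩ := hev.exists
  refine ⟨ρ, hρ, fun a m ⟨h0, h1⟩ => ?_⟩
  -- Since `Cρ < 1`, a value in the window is itself the fractional part; it is positive, hence
  -- should exceed `Cρ`.
  have hfr : Int.fract (y a) = y a - m :=
    Int.fract_eq_iff.2 ⟨by linarith, by linarith, m, by ring⟩
  have := hρy a (by rw [hfr]; linarith)
  linarith

namespace IET

/-- Balls of finite radius stay within one permutation, and there the `ℓ¹` distance dominates the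
sup distance. -/
theorem isOpen_setOf_len_mem {n : ℕ} (σ : Equiv.Perm (Fin n)) {P : Set (Fin n → ℝ)}
    (hP : IsOpen P) :
    IsOpen {T : IET | ∃ l h₁ h₂ h₃, l ∈ P ∧ T = IET.mk n σ l h₁ h₂ h₃} := by
  rw [EMetric.isOpen_iff]
  rintro _ ⟨l, h₁, h₂, h₃, hl, rfl⟩
  obtain ⟨ε, hε, hball⟩ := Metric.isOpen_iff.1 hP l hl
  refine ⟨ENNReal.ofReal ε, ENNReal.ofReal_pos.2 hε, ?_⟩
  intro T hT
  have hT' : edist T (IET.mk n σ l h₁ h₂ h₃) < ENNReal.ofReal ε := hT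
  by_cases h : T.type = (IET.mk n σ l h₁ h₂ h₃).type
  · obtain ⟨n', σ', l', h₁', h₂', h₃'⟩ := T
    cases h
    refine ⟨l', h₁', h₂', h₃', hball ?_, rfl⟩
    rw [edist_mk, ENNReal.ofReal_lt_ofReal_iff hε] at hT'
    rw [Metric.mem_ball]
    refine lt_of_le_of_lt ((dist_pi_le_iff (by positivity)).2 fun i => ?_) hT'
    rw [Real.dist_eq]
    exact Finset.single_le_sum (f := fun i => |l' i - l i|) (fun _ _ => abs_nonneg _)
      (Finset.mem_univ i)
  · rw [edist_of_type_ne h] at hT'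
    exact absurd hT' not_top_lt

theorem continuous_mark {n : ℕ} (σ : Equiv.Perm (Fin n))
    (a : (Fin n ⊕ Fin n) ⊕ (Fin n ⊕ Unit)) : Continuous fun l : Fin n → ℝ => mark σ l a := by
  rcases a with (a | a) | (a | a)
  · exact continuous_leftEnd σ a
  · exact (continuous_leftEnd σ a).add (continuous_apply a)
  · exact continuous_translationLength σ a
  · exact continuous_const

end IET

theorem Driftable.exists_direction {n : ℕ} {σ : Equiv.Perm (Fin n)} (h : Driftable σ) :
    ∃ d : Fin n → ℝ, ∑ i, d i = 0 ∧ ∀ i, 0 < translationLength σ d i := by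
  obtain ⟨l, d, -, -, hd, -, ht⟩ := h
  refine ⟨d, hd, fun i => ?_⟩
  have h1 := translationLength_add_smul σ l d 1 i
  have h2 := ht i
  simp only [one_mul] at h1
  linarith

theorem exists_ratio_bound {n : ℕ} {τ : Fin n → ℝ} (hτ : ∀ i, 0 < τ i) :
    ∃ K : ℝ, 1 < K ∧ ∀ i j, τ i < K * τ j := by
  have hnn : ∀ p : Fin n × Fin n, 0 ≤ τ p.1 / τ p.2 := fun p => (div_pos (hτ _) (hτ _)).le
  refine ⟨2 + ∑ p : Fin n × Fin n, τ p.1 / τ p.2, ?_, fun i j => ?_⟩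
  · have := Finset.sum_nonneg fun p (_ : p ∈ Finset.univ) => hnn p
    linarith
  · rw [← div_lt_iff₀ (hτ j)]
    have := Finset.single_le_sum (f := fun p : Fin n × Fin n => τ p.1 / τ p.2)
      (fun p _ => hnn p) (Finset.mem_univ (i, j))
    simp only at this
    linarith

/-! ### Construction of the two sets and conclusion. -/

open Filter in
theorem mainTheorem2 (q : ℕ) (hq : 0 < q) (T₀ : IET) (hT₀ : T₀.IsQRational q)
    (hdrift : Driftable T₀.perm) (S : IET) :
    ∃ U V : Set IET,
      S ∈ U ∧
      IsOpen V ∧ (∀ T ∈ V, T.type = T₀.type) ∧ AccPt T₀ (Filter.principal V) ∧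
      (∀ R ∈ U, ∀ T ∈ V,
        ¬ Nonempty (Subgroup.closure {R.toPerm, T.toPerm} ≃* FreeGroup (Fin 2)) ∧
        ∃ k : ℕ, 0 < k ∧
          driftWord q k (FreeGroup.of (0 : Fin 2)) (FreeGroup.of (1 : Fin 2)) ≠ 1 ∧
          driftWord q k R.toPerm T.toPerm = 1) ∧
      ((S.IsRational ∨
          ∀ x ∈ S.disc, ∀ y ∈ S.disc, x ≠ y → ¬ ∃ m : ℤ, x - y = m / q) →
        U ∈ 𝓝 S) := by
  have hq' : (0 : ℝ) < q := by exact_mod_cast hq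
  have hrat := hT₀.exists_int_len hq
  obtain ⟨n, σ, l₀, h₁, h₂, h₃⟩ := T₀
  obtain ⟨nS, σS, lS, hS₁, hS₂, hS₃⟩ := S
  simp only at hrat hdrift
  have hn : 0 < n := by
    rcases Nat.eq_zero_or_pos n with rfl | h
    · simp at h₂
    · exact h
  obtain ⟨d, hd, htd⟩ := hdrift.exists_direction
  obtain ⟨K, hK, hKd⟩ := exists_ratio_bound htd
  -- `ρ` depends only on `q`, `K` and the marks of `S`, so it is fixed before `R` and `T` are
  -- chosen.
  obtain ⟨ρ, hρ, hsep⟩ := exists_separation_scale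
    (fun p : ((Fin nS ⊕ Fin nS) ⊕ (Fin nS ⊕ Unit)) × ((Fin nS ⊕ Fin nS) ⊕ (Fin nS ⊕ Unit)) =>
      q * (IET.mark σS lS p.1 - IET.mark σS lS p.2)) (6 * K)
  set c := ρ / 8 with hcdef
  have hρc : 8 * c = ρ := by rw [hcdef]; ring
  have hc : 0 < c := by linarith
  set η := c / (q.factorial + 1) with hηdef
  have hη : 0 < η := by positivity
  have hηc : ((q.factorial : ℝ) + 1) * η = c := by rw [hηdef]; field_simp
  let W : Set (Fin nS → ℝ) := {l | ∀ a, |q * (IET.mark σS l a - IET.mark σS lS a)| < 4 * c}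
  have hW : IsOpen W := by
    simp only [W, Set.ofPred_forall]
    refine isOpen_iInter_of_finite fun a => isOpen_lt ?_ continuous_const
    exact (continuous_const.mul ((IET.continuous_mark σS a).sub continuous_const)).abs
  let τ : (Fin n → ℝ) → Fin n → ℝ := fun l i => translationLength σ l i - translationLength σ l₀ i
  have hτcont : ∀ i, Continuous fun l => τ l i := fun i =>
    (continuous_translationLength σ i).sub continuous_const
  let Near : Set (Fin n → ℝ) := {l | ∀ i, |q * (leftEnd 1 l i - leftEnd 1 l₀ i)| < η ∧
    |q * ((leftEnd 1 l i + l i) - (leftEnd 1 l₀ i + l₀ i))| < η ∧ |q * τ l i| < η}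
  have hNear : IsOpen Near := by
    simp only [Near, Set.ofPred_forall]
    refine isOpen_iInter_of_finite fun i => ?_
    have hL := continuous_leftEnd (1 : Equiv.Perm (Fin n)) i
    have c₁ : Continuous fun l => |q * (leftEnd 1 l i - leftEnd 1 l₀ i)| :=
      (continuous_const.mul (hL.sub continuous_const)).abs
    have c₂ : Continuous fun l => |q * ((leftEnd 1 l i + l i) - (leftEnd 1 l₀ i + l₀ i))| :=
      (continuous_const.mul ((hL.add (continuous_apply i)).sub continuous_const)).abs
    have c₃ : Continuous fun l => |q * τ l i| := (continuous_const.mul (hτcont i)).abs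
    exact (isOpen_lt c₁ continuous_const).inter
      ((isOpen_lt c₂ continuous_const).inter (isOpen_lt c₃ continuous_const))
  -- This condition is homogeneous in the drift `τ`, so the speed ratio stays bounded by `K` however
  -- close `T` is to `T₀`. The case `i = j` with `K > 1` forces positive drift.
  let Cone : Set (Fin n → ℝ) := {l | ∀ i j, τ l i < K * τ l j}
  have hCone : IsOpen Cone := by
    simp only [Cone, Set.ofPred_forall]
    exact isOpen_iInter_of_finite fun i => isOpen_iInter_of_finite fun j =>
      isOpen_lt (hτcont i) (continuous_const.mul (hτcont j))
  have hConePos : ∀ l ∈ Cone, ∀ i, 0 < τ l i := fun l hl i => by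
    have h : τ l i < K * τ l i := hl i i
    have h' : 0 < (K - 1) * τ l i := by linarith
    exact pos_of_mul_pos_right h' (by linarith)
  let U : Set IET := {R | ∃ l h₁ h₂ h₃, l ∈ W ∧ R = IET.mk nS σS l h₁ h₂ h₃}
  let V : Set IET := {T | ∃ l h₁ h₂ h₃, l ∈ Near ∩ Cone ∧ T = IET.mk n σ l h₁ h₂ h₃}
  have hSU : IET.mk nS σS lS hS₁ hS₂ hS₃ ∈ U :=
    ⟨lS, hS₁, hS₂, hS₃, fun a => by simpa using hc, rfl⟩
  refine ⟨U, V, hSU, IET.isOpen_setOf_len_mem σ (hNear.inter hCone), ?_, ?_, ?_,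
    fun _ => (IET.isOpen_setOf_len_mem σS hW).mem_nhds hSU⟩
  · rintro _ ⟨l, _, _, _, -, rfl⟩
    rfl
  · rw [accPt_iff_frequently, Metric.nhds_basis_eball.frequently_iff]
    intro ε hε
    -- Along the drift direction `τ` is proportional to that of `d`, so every `s > 0` satisfies the
    -- cone condition.
    let path : ℝ → Fin n → ℝ := fun s i => l₀ i + s * d i
    have hpath : Continuous path := by fun_prop
    have hpath0 : path 0 = l₀ := by simp [path]
    have hτpath : ∀ s i, τ (path s) i = s * translationLength σ d i := fun s i => by
      simp only [τ, path, translationLength_add_smul]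
      ring
    have hpos : IsOpen {l : Fin n → ℝ | ∀ i, 0 < l i} := by
      simp only [Set.ofPred_forall]
      exact isOpen_iInter_of_finite fun i => isOpen_lt continuous_const (continuous_apply i)
    have e₁ : ∀ᶠ s in 𝓝[>] (0 : ℝ), path s ∈ Near :=
      (hpath.continuousAt.eventually_mem (by
        rw [hpath0]
        exact hNear.mem_nhds fun i => by simpa [τ] using hη)).filter_mono nhdsWithin_le_nhds
    have e₂ : ∀ᶠ s in 𝓝[>] (0 : ℝ), path s ∈ {l : Fin n → ℝ | ∀ i, 0 < l i} :=
      (hpath.continuousAt.eventually_mem (by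
        rw [hpath0]
        exact hpos.mem_nhds h₁)).filter_mono nhdsWithin_le_nhds
    have e₃ : ∀ᶠ s in 𝓝[>] (0 : ℝ), ENNReal.ofReal (∑ i, |path s i - l₀ i|) < ε := by
      have hcont : Continuous fun s => ENNReal.ofReal (∑ i, |path s i - l₀ i|) := by
        refine ENNReal.continuous_ofReal.comp ?_
        fun_prop
      have := hcont.tendsto 0
      simp only [hpath0, sub_self, abs_zero, Finset.sum_const_zero, ENNReal.ofReal_zero] at this
      exact (this.eventually_lt_const hε).filter_mono nhdsWithin_le_nhds
    obtain ⟨s, hs, hs₁, hs₂, hs₃⟩ :=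
      (eventually_mem_nhdsWithin.and (e₁.and (e₂.and e₃))).exists
    have hs0 : 0 < s := hs
    have hsum : ∑ i, path s i = 1 := by
      simp only [path, Finset.sum_add_distrib, ← Finset.mul_sum, hd, h₂]
      ring
    have hcone : path s ∈ Cone := fun i j => by
      rw [hτpath, hτpath, mul_left_comm]
      exact mul_lt_mul_of_pos_left (hKd i j) hs0
    refine ⟨IET.mk n σ (path s) hs₂ hsum h₃, ?_, ?_, ⟨path s, hs₂, hsum, h₃, ⟨hs₁, hcone⟩, rfl⟩⟩
    · change edist _ _ < ε
      rw [IET.edist_mk]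
      exact hs₃
    · intro heq
      have hl : path s = l₀ := by
        simpa using heq
      have := hConePos _ hcone ⟨0, hn⟩
      rw [hl] at this
      simp [τ] at this
  · rintro _ ⟨lR, hR₁, hR₂, hR₃, hlR, rfl⟩ _ ⟨l, h₁', h₂', h₃', ⟨hnear, hcone⟩, rfl⟩
    have hτpos := hConePos l hcone
    obtain ⟨j, -, hj⟩ := Finset.exists_min_image Finset.univ (fun i => τ l i) ⟨⟨0, hn⟩, by simp⟩
    set δ := q * τ l j with hδ
    have hδ0 : 0 < δ := mul_pos hq' (hτpos j)
    have hδc : δ ≤ c := by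
      have h := (le_abs_self _).trans (hnear j).2.2.le
      have : 0 ≤ (q.factorial : ℝ) * η := by positivity
      linarith
    obtain ⟨D, hD⟩ := IET.exists_translatesCores hq h₁ h₂ h₃' h₁' h₂' hrat hη hηc.le
      (fun i => (hnear i).1) (fun i => (hnear i).2.1)
      (fun i => ⟨(mul_pos hq' (hτpos i)).le, (le_abs_self _).trans (hnear i).2.2.le⟩)
    -- The slowest speed is `δ ≤ c = ρ/8`, so rounding up overshoots `3ρ` by at most `ρ`; faster
    -- points then travel at most `4Kρ`.
    let k := ⌈3 * ρ / δ⌉₊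
    have hk0 : 0 < k := Nat.ceil_pos.2 (by positivity)
    have hk1 : 3 * ρ ≤ k * δ := by
      rw [← div_le_iff₀ hδ0]
      exact Nat.le_ceil _
    have hk2 : k * δ ≤ 4 * ρ := by
      have h := (Nat.ceil_lt_add_one (show 0 ≤ 3 * ρ / δ by positivity)).le
      have h' := mul_le_mul_of_nonneg_right h hδ0.le
      rw [add_mul, div_mul_cancel₀ _ hδ0.ne'] at h'
      have : (k : ℝ) * δ ≤ 3 * ρ + 1 * δ := h'
      linarith
    have hw : driftWord q k (IET.mk nS σS lR hR₁ hR₂ hR₃).toPerm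
        (IET.mk n σ l h₁' h₂' h₃').toPerm = 1 := by
      refine IET.driftWord_eq_one_of_drift hq hc hK.le hD _ (IET.mark σS lS)
        (fun a => (hlR a).le) (fun a b m => by rw [hρc]; exact hsep (a, b) m) fun x => ?_
      obtain ⟨m, hm0, hm1⟩ := IET.exists_int_drift h₃' h₁' h₂' hrat (δ := δ) (δ' := K * δ)
        (fun i => ⟨mul_le_mul_of_nonneg_left (hj i (Finset.mem_univ i)) hq'.le, by
          rw [hδ, mul_left_comm]
          exact mul_le_mul_of_nonneg_left (hcone i j).le hq'.le⟩) k x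
      refine ⟨m, by linarith, hm1.trans ?_⟩
      have := mul_le_mul_of_nonneg_left hk2 (show 0 ≤ K by linarith)
      rw [hρc]
      linarith
    exact ⟨closure_pair_not_free q k hk0 _ _ hw, k, hk0, driftWord_freeGroup_ne_one q k hk0, hw⟩
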